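/- Let $X$ be a (real) Banach lattice with order continuous norm (every net $x_\alpha\downarrow 0$ satisfies $\|x_\alpha\|\to 0$) and with a weak unit, i.e. a vector $e\ge 0$ such that $|x|\wedge e=0$ implies $x=0$ for $x \in X$. Let $\mu$ be a finite measure and let $T\colon X\to L_1(\mu)$ be an AL-representation of $X$, that is, an injective linear lattice homomorphism whose range is an order dense and norm dense ideal of $L_1(\mu)$ ($T$ is not required to preserve the norm). Then for every sequence $(x_n)$ in $X$ the following are equivalent: (i) $(x_n)$ is un-null in $X$, i.e. $\bigl\||x_n|\wedge u\bigr\|\to 0$ for every $u\in X_+$; (ii) $Tx_n\to 0$ in measure, i.e. $\mu\bigl(\{|Tx_n|\ge\varepsilon\}\bigr)\to 0$ for every $\varepsilon>0$. -/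

import Mathlib

open MeasureTheory Filter Topology

/-- The norm of a Banach lattice `X` is order continuous: every net decreasing to `0` in order
converges to `0` in norm. A decreasing net is given by its range, a nonempty downward directed
set `s`; as the norm is monotone on the positive cone, norm convergence to `0` of such a net means
that `s` has elements of arbitrarily small norm. -/
def IsOrderContinuousNorm (X : Type*) [NormedAddCommGroup X] [Lattice X] : Prop :=
  ∀ s : Set X, s.Nonempty → DirectedOn (fun a b => b ≤ a) s → IsGLB s 0 →
    ∀ ε : ℝ, 0 < ε → ∃ a ∈ s, ‖a‖ < ε

/-- `e` is a weak (order) unit: a positive vector such that only `0` is disjoint from it. -/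
def IsWeakUnit {X : Type*} [AddCommGroup X] [Lattice X] (e : X) : Prop :=
  0 ≤ e ∧ ∀ x : X, |x| ⊓ e = 0 → x = 0

/-- Unbounded norm convergence of a family `x` along a filter `l` to `a`:
`|x i - a| ⊓ u → 0` in norm for every `u ≥ 0`. -/
def UnTendsto {X ι : Type*} [NormedAddCommGroup X] [Lattice X]
    (x : ι → X) (l : Filter ι) (a : X) : Prop :=
  ∀ u : X, 0 ≤ u → Tendsto (fun i => |x i - a| ⊓ u) l (𝓝 0)

/-- `T` is an AL-representation of the vector lattice `X`: it is a vector lattice isomorphism of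
`X` onto an order dense and norm dense ideal of `L₁(μ)`. -/
structure IsALRepresentation {X Ω : Type*} [NormedAddCommGroup X] [NormedSpace ℝ X] [Lattice X]
    [MeasurableSpace Ω] (μ : Measure Ω) (T : X →ₗ[ℝ] Lp ℝ 1 μ) : Prop where
  injective : Function.Injective T
  map_sup : ∀ x y : X, T (x ⊔ y) = T x ⊔ T y
  map_inf : ∀ x y : X, T (x ⊓ y) = T x ⊓ T y
  ideal : ∀ f g : Lp ℝ 1 μ, |f| ≤ |g| → g ∈ Set.range T → f ∈ Set.range T
  order_dense : ∀ f : Lp ℝ 1 μ, 0 < f → ∃ g ∈ Set.range T, 0 < g ∧ g ≤ f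
  norm_dense : Dense (Set.range T)

section LatticeRepresentation

variable {X : Type*} [NormedAddCommGroup X] [NormedSpace ℝ X] [Lattice X]
  {Ω : Type*} [MeasurableSpace Ω] {μ : Measure Ω} {T : X →ₗ[ℝ] Lp ℝ 1 μ}

/-! Over a finite measure, un-null sequences in `L₁` are those null in measure, so it suffices to
move un-convergence through `T`. Forward, `T` is positive, hence bounded, and its dense range
supplies enough test vectors. Backward, `|x n| ⊓ u` is order bounded with norm-null image. A
subsequence has summable images, whose tails, cut down by `T u`, lift through the ideal to upper
bounds in `X` with infimum `0`; order continuity concludes. -/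

theorem IsALRepresentation.map_le_map_iff (hT : IsALRepresentation μ T) {x y : X} :
    T x ≤ T y ↔ x ≤ y := by
  rw [← inf_eq_left, ← hT.map_inf, hT.injective.eq_iff, inf_eq_left]

theorem IsALRepresentation.map_abs (hT : IsALRepresentation μ T) (x : X) : T |x| = |T x| := by
  rw [abs, abs, hT.map_sup, map_neg]

end LatticeRepresentation

/-- Positive operators from a Banach lattice to a normed lattice are bounded. -/
theorem exists_norm_map_le_of_monotone {X Y : Type*} [NormedAddCommGroup X] [NormedSpace ℝ X]
    [CompleteSpace X] [Lattice X] [IsOrderedAddMonoid X] [HasSolidNorm X]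
    [NormedAddCommGroup Y] [NormedSpace ℝ Y] [Lattice Y] [IsOrderedAddMonoid Y] [HasSolidNorm Y]
    (T : X →ₗ[ℝ] Y) (hT : Monotone T) : ∃ C : ℝ, ∀ x, ‖T x‖ ≤ C * ‖x‖ := by
  by_contra! h
  have key : ∀ n : ℕ, ∃ x : X, ‖x‖ ≤ (1 / 2 : ℝ) ^ n ∧ (n : ℝ) < ‖T x‖ := by
    intro n
    -- After rescaling to norm `2⁻ⁿ`, the image still has norm above `n`.
    obtain ⟨x, hx⟩ := h (n * 2 ^ n)
    have hx0 : 0 < ‖x‖ := by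
      rw [norm_pos_iff]
      rintro rfl
      simp at hx
    refine ⟨((1 / 2 : ℝ) ^ n * ‖x‖⁻¹) • x, ?_, ?_⟩
    · rw [norm_smul, Real.norm_of_nonneg (by positivity), mul_assoc, inv_mul_cancel₀ hx0.ne',
        mul_one]
    · rw [map_smul, norm_smul, Real.norm_of_nonneg (by positivity)]
      have h2 : (1 / 2 : ℝ) ^ n * ‖x‖⁻¹ * (n * 2 ^ n * ‖x‖) = n := by
        rw [one_div, inv_pow]
        field_simp
      calc (n : ℝ) = (1 / 2 : ℝ) ^ n * ‖x‖⁻¹ * (n * 2 ^ n * ‖x‖) := h2.symm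
        _ < _ := by gcongr
  choose x hx hTx using key
  have hs : Summable fun n => |x n| :=
    Summable.of_norm_bounded summable_geometric_two fun n => by
      rw [norm_abs_eq_norm]
      exact hx n
  obtain ⟨n, hn⟩ := exists_nat_gt ‖T (∑' n, |x n|)‖
  refine (hn.trans (hTx n)).not_ge (HasSolidNorm.solid ?_)
  have h1 : |x n| ≤ ∑' n, |x n| := hs.le_tsum n fun _ _ => abs_nonneg _
  have h2 : |T (x n)| ≤ T (∑' n, |x n|) := by
    refine abs_le'.2 ⟨hT ((le_abs_self _).trans h1), ?_⟩
    rw [← map_neg]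
    exact hT ((neg_le_abs _).trans h1)
  exact h2.trans (le_abs_self _)

/-- In `L₁` of a finite measure, unbounded norm convergence to `0` of a sequence is convergence in
measure. -/
theorem unTendsto_Lp_one_iff_tendstoInMeasure {Ω : Type*} [MeasurableSpace Ω] {μ : Measure Ω}
    [IsFiniteMeasure μ] (f : ℕ → Lp ℝ 1 μ) :
    UnTendsto f atTop 0 ↔
      TendstoInMeasure μ (fun n => (f n : Ω → ℝ)) atTop (fun _ => (0 : ℝ)) := by
  have hcoe : ∀ (n : ℕ) (g : Lp ℝ 1 μ), ((|f n| ⊓ g : Lp ℝ 1 μ) : Ω → ℝ) =ᵐ[μ]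
      fun ω => |f n ω| ⊓ g ω := by
    intro n g
    filter_upwards [Lp.coeFn_inf |f n| g, Lp.coeFn_abs (f n)] with ω h1 h2
    rw [h1, Pi.inf_apply, h2]
  simp only [UnTendsto, sub_zero]
  constructor
  · intro h
    have h1 : (0 : Lp ℝ 1 μ) ≤ Lp.const 1 μ (1 : ℝ) := by
      rw [← Lp.coeFn_nonneg]
      filter_upwards [Lp.coeFn_const 1 μ (1 : ℝ)] with ω hω
      rw [hω]
      exact zero_le_one
    have h2 := tendstoInMeasure_of_tendsto_Lp (h _ h1)
    rw [tendstoInMeasure_iff_norm] at h2 ⊢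
    intro ε hε
    -- Truncation at `1` hides levels above `1`, hence the threshold `ε ⊓ 1`.
    refine tendsto_of_tendsto_of_tendsto_of_le_of_le tendsto_const_nhds
      (h2 (ε ⊓ 1) (lt_inf_iff.2 ⟨hε, one_pos⟩)) (fun _ => bot_le) fun n => ?_
    refine measure_mono_ae ?_
    filter_upwards [hcoe n (Lp.const 1 μ (1 : ℝ)), Lp.coeFn_const 1 μ (1 : ℝ),
      Lp.coeFn_zero ℝ 1 μ] with ω h3 h4 h5 h6
    have h6 : ε ≤ ‖f n ω - 0‖ := h6
    change ε ⊓ 1 ≤ ‖_ - _‖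
    rw [h3, h4, h5, Pi.zero_apply, sub_zero, Function.const_apply]
    rw [sub_zero, Real.norm_eq_abs] at h6
    exact (inf_le_inf_right 1 h6).trans (le_abs_self _)
  · intro h g hg
    refine tendsto_of_subseq_tendsto fun ns hns => ?_
    obtain ⟨ms, -, hms⟩ := (h.comp hns).exists_seq_tendsto_ae
    refine ⟨ms, ?_⟩
    rw [tendsto_zero_iff_norm_tendsto_zero]
    simp only [L1.norm_eq_integral_norm]
    rw [← integral_zero Ω ℝ (μ := μ)]
    refine tendsto_integral_of_dominated_convergence (g : Ω → ℝ)
      (fun n => (Lp.aestronglyMeasurable _).norm) (L1.integrable_coeFn g) (fun n => ?_) ?_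
    · filter_upwards [hcoe (ns (ms n)) g, (Lp.coeFn_nonneg g).2 hg] with ω h1 h2
      rw [norm_norm, h1, Real.norm_of_nonneg (le_inf (abs_nonneg _) h2)]
      exact inf_le_right
    · filter_upwards [hms, ae_all_iff.2 fun n => hcoe (ns (ms n)) g,
        (Lp.coeFn_nonneg g).2 hg] with ω h1 h2 h3
      have h4 : Tendsto (fun n => |f (ns (ms n)) ω|) atTop (𝓝 0) := by simpa using h1.abs
      refine squeeze_zero (fun _ => norm_nonneg _) (fun n => ?_) h4
      rw [h2, Real.norm_of_nonneg (le_inf (abs_nonneg _) h3)]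
      exact inf_le_left

/-- An order bounded sequence of positive vectors of a lattice with order continuous norm tends to
`0` as soon as its image under an AL-representation does. -/
theorem IsALRepresentation.tendsto_zero_of_map_tendsto_zero {X : Type*} [NormedAddCommGroup X]
    [NormedSpace ℝ X] [Lattice X] [IsOrderedAddMonoid X] [HasSolidNorm X]
    (hoc : IsOrderContinuousNorm X) {Ω : Type*} [MeasurableSpace Ω] {μ : Measure Ω}
    {T : X →ₗ[ℝ] Lp ℝ 1 μ} (hT : IsALRepresentation μ T) {y : ℕ → X} {u : X}
    (hy : ∀ n, 0 ≤ y n) (hyu : ∀ n, y n ≤ u) (h : Tendsto (fun n => T (y n)) atTop (𝓝 0)) :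
    Tendsto y atTop (𝓝 0) := by
  refine tendsto_of_subseq_tendsto fun ns hns => ?_
  have hT0 : ∀ n, 0 ≤ T (y n) := fun n => by
    rw [← map_zero T, hT.map_le_map_iff]
    exact hy n
  have hTu : 0 ≤ T u := (hT0 0).trans (hT.map_le_map_iff.2 (hyu 0))
  have hev : ∀ k : ℕ, ∀ᶠ n in atTop, ‖T (y (ns n))‖ < (1 / 2 : ℝ) ^ k := fun k =>
    (h.comp hns).norm.eventually_lt_const (by simp)
  obtain ⟨ms, -, hms⟩ := extraction_forall_of_eventually hev
  refine ⟨ms, ?_⟩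
  set f : ℕ → Lp ℝ 1 μ := fun k => T (y (ns (ms k))) with hf
  have hsum : Summable f :=
    Summable.of_norm_bounded summable_geometric_two fun k => (hms k).le
  have htail : ∀ N, ∃ z : X, T z ≤ ∑' k, f (k + N) ∧ ∀ n, N ≤ n → y (ns (ms n)) ≤ z := by
    intro N
    have hsN : Summable fun k => f (k + N) := (summable_nat_add_iff N).2 hsum
    have h0 : 0 ≤ ∑' k, f (k + N) := tsum_nonneg fun k => hT0 _
    -- The tail itself may lie outside the range of `T`; its infimum with `T u` does not.
    obtain ⟨z, hz⟩ := hT.ideal ((∑' k, f (k + N)) ⊓ T u) (T u)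
      (by rw [abs_of_nonneg (le_inf h0 hTu), abs_of_nonneg hTu]; exact inf_le_right) ⟨u, rfl⟩
    refine ⟨z, hz ▸ inf_le_left, fun n hn => ?_⟩
    rw [← hT.map_le_map_iff, hz]
    refine le_inf ?_ (hT.map_le_map_iff.2 (hyu _))
    have h1 := hsN.le_tsum (n - N) fun _ _ => hT0 _
    rwa [Nat.sub_add_cancel hn] at h1
  -- The image of a lower bound lies below every tail, and the tails tend to `0`.
  have hglb : IsGLB {z : X | ∃ N, ∀ n, N ≤ n → y (ns (ms n)) ≤ z} 0 := by
    refine ⟨fun z ⟨N, hz⟩ => (hy _).trans (hz N le_rfl), fun w hw => ?_⟩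
    rw [← hT.map_le_map_iff, map_zero]
    refine ge_of_tendsto' (tendsto_sum_nat_add f) fun N => ?_
    obtain ⟨z, hz, hyz⟩ := htail N
    exact (hT.map_le_map_iff.2 (hw ⟨N, hyz⟩)).trans hz
  have hdir : DirectedOn (fun a b => b ≤ a) {z : X | ∃ N, ∀ n, N ≤ n → y (ns (ms n)) ≤ z} := by
    rintro a ⟨M, ha⟩ b ⟨N, hb⟩
    exact ⟨a ⊓ b, ⟨max M N, fun n hn => le_inf (ha n (le_of_max_le_left hn))
      (hb n (le_of_max_le_right hn))⟩, inf_le_left, inf_le_right⟩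
  rw [NormedAddGroup.tendsto_nhds_zero]
  intro ε hε
  obtain ⟨z, ⟨N, hz⟩, hzε⟩ := hoc _ (by exact ⟨u, 0, fun _ _ => hyu _⟩) hdir hglb ε hε
  filter_upwards [eventually_ge_atTop N] with n hn
  refine (HasSolidNorm.solid ?_).trans_lt hzε
  rw [abs_of_nonneg (hy _)]
  exact (hz n hn).trans (le_abs_self z)

/-- Infimum with a fixed vector is 1-Lipschitz, so a test vector `g` may be replaced by a nearby `T
|u|`, where boundedness of `T` applies. -/
theorem IsALRepresentation.unTendsto_map {X : Type*} [NormedAddCommGroup X] [NormedSpace ℝ X]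
    [CompleteSpace X] [Lattice X] [IsOrderedAddMonoid X] [HasSolidNorm X]
    {Ω : Type*} [MeasurableSpace Ω] {μ : Measure Ω} {T : X →ₗ[ℝ] Lp ℝ 1 μ}
    (hT : IsALRepresentation μ T) {ι : Type*} {l : Filter ι} {x : ι → X} (hx : UnTendsto x l 0) :
    UnTendsto (fun n => T (x n)) l 0 := by
  obtain ⟨C, hC⟩ := exists_norm_map_le_of_monotone T fun _ _ => hT.map_le_map_iff.2
  intro g hg
  simp only [sub_zero]
  rw [NormedAddGroup.tendsto_nhds_zero]
  intro ε hε
  obtain ⟨_, ⟨u, rfl⟩, hu⟩ := hT.norm_dense.exists_dist_lt g (half_pos hε)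
  have hu' : ‖g - T |u|‖ < ε / 2 := by
    refine lt_of_le_of_lt ?_ (dist_eq_norm_sub g (T u) ▸ hu)
    rw [hT.map_abs]
    nth_rewrite 1 [← abs_of_nonneg hg]
    exact norm_abs_sub_abs g (T u)
  have h1 : Tendsto (fun n => C * ‖|x n| ⊓ |u|‖) l (𝓝 0) := by
    simpa using (hx |u| (abs_nonneg u)).norm.const_mul C
  filter_upwards [h1.eventually_lt_const (half_pos hε)] with n hn
  have h2 : ‖|T (x n)| ⊓ T |u|‖ < ε / 2 := by
    rw [← hT.map_abs, ← hT.map_inf]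
    exact (hC _).trans_lt hn
  have h3 : ‖|T (x n)| ⊓ g - |T (x n)| ⊓ T |u|‖ ≤ ‖g - T |u|‖ := by
    rw [inf_comm _ g, inf_comm _ (T |u|)]
    exact norm_inf_sub_inf_le_norm _ _ _
  calc ‖|T (x n)| ⊓ g‖ = ‖(|T (x n)| ⊓ g - |T (x n)| ⊓ T |u|) + |T (x n)| ⊓ T |u|‖ := by
        rw [sub_add_cancel]
    _ ≤ ‖|T (x n)| ⊓ g - |T (x n)| ⊓ T |u|‖ + ‖|T (x n)| ⊓ T |u|‖ := norm_add_le _ _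
    _ < ε := by linarith

theorem mainTheorem3 {X : Type*} [NormedAddCommGroup X] [NormedSpace ℝ X] [CompleteSpace X]
    [Lattice X] [IsOrderedAddMonoid X] [IsOrderedModule ℝ X] [HasSolidNorm X]
    (hoc : IsOrderContinuousNorm X) (hwu : ∃ e : X, IsWeakUnit e)
    {Ω : Type*} [MeasurableSpace Ω] (μ : Measure Ω) [IsFiniteMeasure μ]
    (T : X →ₗ[ℝ] Lp ℝ 1 μ) (hT : IsALRepresentation μ T) (x : ℕ → X) :
    UnTendsto x atTop 0 ↔
      TendstoInMeasure μ (fun n => (T (x n) : Ω → ℝ)) atTop (fun _ => (0 : ℝ)) := by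
  rw [← unTendsto_Lp_one_iff_tendstoInMeasure]
  refine ⟨hT.unTendsto_map, fun h u hu => ?_⟩
  simp only [sub_zero]
  refine hT.tendsto_zero_of_map_tendsto_zero hoc (fun n => le_inf (abs_nonneg _) hu)
    (fun n => inf_le_right) ?_
  have hTu : 0 ≤ T u := by
    rw [← map_zero T, hT.map_le_map_iff]
    exact hu
  simpa only [hT.map_inf, hT.map_abs, sub_zero] using h (T u) hTu
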